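/- Let $K$ be a field and $n$ a positive integer. Let $R=K[x_{ij},\,y_k : 1\le i<j\le n,\ 1\le k\le n]$ be the polynomial ring in the indicated indeterminates, let $X$ be the generic skew-symmetric $n\times n$ matrix over $R$, whose $(i,j)$ entry is $x_{ij}$ if $i<j$, $-x_{ji}$ if $i>j$, and $0$ if $i=j$, and let $Y=(y_1,\dots,y_n)^{T}$. Let $g_1,\dots,g_n\in R$ be the entries of the column $XY$, that is, $$g_i=\sum_{j>i}x_{ij}y_j-\sum_{j<i}x_{ji}y_j\qquad(1\le i\le n).$$ Then: (i) $g_1,\dots,g_{n-1}$ is a regular sequence in $R$; that is, for each $1\le i\le n-1$ the element $g_i$ is a nonzerodivisor on $R/\langle g_1,\dots,g_{i-1}\rangle$, and $\langle g_1,\dots,g_{n-1}\rangle\ne R$. (ii) For every integer $t$ with $1\le t\le n-2$, the ideal $\mathcal J_t=\langle g_1,\dots,g_t\rangle$ is a prime ideal of $R$. -/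

import Mathlib

namespace GenericSkew

/-- The polynomial ring `K[x_{ij}, y_k : 1 ≤ i < j ≤ n, 1 ≤ k ≤ n]`; indices run over `Fin n`,
so they are shifted by one. The left summand indexes the `x_{ij}`, the right one the `y_k`. -/
abbrev PolyRing (K : Type*) [Field K] (n : ℕ) : Type _ :=
  MvPolynomial ({p : Fin n × Fin n // p.1 < p.2} ⊕ Fin n) K

/-- The generic skew-symmetric `n × n` matrix: `x_{ij}` above the diagonal, `-x_{ji}` below it,
and zero on the diagonal. -/
noncomputable def skewMatrix (K : Type*) [Field K] (n : ℕ) :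
    Matrix (Fin n) (Fin n) (PolyRing K n) :=
  Matrix.of fun i j =>
    if h : i < j then MvPolynomial.X (Sum.inl ⟨(i, j), h⟩)
    else if h : j < i then -MvPolynomial.X (Sum.inl ⟨(j, i), h⟩)
    else 0

/-- The generic column `(y_1, …, y_n)`. -/
noncomputable def genericColumn (K : Type*) [Field K] (n : ℕ) : Fin n → PolyRing K n :=
  fun k => MvPolynomial.X (Sum.inr k)

/-- The entries `g_1, …, g_n` of the product of the generic skew-symmetric matrix and the
generic column. -/
noncomputable def g (K : Type*) [Field K] (n : ℕ) : Fin n → PolyRing K n :=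
  Matrix.mulVec (skewMatrix K n) (genericColumn K n)

/-- The ideal generated by the first `t` of the entries `g_1, …, g_n`. -/
noncomputable def J (K : Type*) [Field K] (n t : ℕ) : Ideal (PolyRing K n) :=
  Ideal.span {f | ∃ i : Fin n, (i : ℕ) < t ∧ f = g K n i}

end GenericSkew

namespace GenericSkew

open MvPolynomial

variable {K : Type*} [Field K] {n : ℕ}

/-- The entries of the product of the generic skew-symmetric matrix and the generic column
in which all `y_j` with `m ≤ j` have been replaced by zero. -/
noncomputable def truncG (K : Type*) [Field K] {n : ℕ} (m : ℕ) (i : Fin n) : PolyRing K n :=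
  ∑ j : Fin n, if (j : ℕ) < m then skewMatrix K n i j * genericColumn K n j else 0

/-- The ideal generated by the first `t` of the truncated entries. -/
noncomputable def truncJ (K : Type*) [Field K] (n m t : ℕ) : Ideal (PolyRing K n) :=
  Ideal.span {f | ∃ i : Fin n, (i : ℕ) < t ∧ f = truncG K m i}

lemma truncG_self (i : Fin n) : truncG K n i = g K n i := by
  simp [truncG, g, Matrix.mulVec, dotProduct]

lemma truncJ_self (t : ℕ) : truncJ K n n t = J K n t := by
  simp [truncJ, J, truncG_self]

lemma truncG_succ (l i : Fin n) :
    truncG K ((l : ℕ) + 1) i = truncG K l i + skewMatrix K n i l * X (Sum.inr l) := by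
  have h : skewMatrix K n i l * X (Sum.inr l) =
      ∑ j : Fin n, if j = l then skewMatrix K n i j * genericColumn K n j else 0 := by
    simp [genericColumn]
  rw [h, truncG, truncG, ← Finset.sum_add_distrib]
  refine Finset.sum_congr rfl fun j _ => ?_
  rcases lt_trichotomy j l with hj | hj | hj
  · have : (j : ℕ) < l := hj
    simp [hj.ne, this, Nat.lt_succ_of_lt this]
  · simp [hj]
  · have : (l : ℕ) < j := hj
    simp [hj.ne', show ¬ (j : ℕ) < l by omega, show ¬ (j : ℕ) < l + 1 by omega]

lemma truncG_mem_truncJ {m t : ℕ} {i : Fin n} (h : (i : ℕ) < t) :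
    truncG K m i ∈ truncJ K n m t :=
  Ideal.subset_span ⟨i, h, rfl⟩

lemma truncJ_le_iff {m t : ℕ} {I : Ideal (PolyRing K n)} :
    truncJ K n m t ≤ I ↔ ∀ i : Fin n, (i : ℕ) < t → truncG K m i ∈ I := by
  rw [truncJ, Ideal.span_le]
  exact ⟨fun h i hi => h ⟨i, hi, rfl⟩, by rintro h _ ⟨i, hi, rfl⟩; exact h i hi⟩

lemma truncJ_zero (m : ℕ) : truncJ K n m 0 = ⊥ :=
  le_bot_iff.mp (truncJ_le_iff.mpr fun _ h => absurd h (Nat.not_lt_zero _))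

lemma truncJ_mono {m s t : ℕ} (h : s ≤ t) : truncJ K n m s ≤ truncJ K n m t :=
  truncJ_le_iff.mpr fun _ hi => truncG_mem_truncJ (hi.trans_le h)

lemma truncJ_succ_le (m : ℕ) (i : Fin n) :
    truncJ K n m ((i : ℕ) + 1) ≤ truncJ K n m i ⊔ Ideal.span {truncG K m i} := by
  refine truncJ_le_iff.mpr fun j hj => ?_
  rcases Nat.lt_succ_iff_lt_or_eq.mp hj with h | h
  · exact Ideal.mem_sup_left (truncG_mem_truncJ h)
  · rw [Fin.ext h]
    exact Ideal.mem_sup_right (Ideal.mem_span_singleton_self _)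

/-- The endomorphism of the polynomial ring that sends `y_l` to zero and fixes the other
variables. -/
noncomputable def killY (K : Type*) [Field K] {n : ℕ} (l : Fin n) :
    PolyRing K n →ₐ[K] PolyRing K n :=
  aeval (Sum.elim (fun p => X (Sum.inl p)) fun k => if k = l then 0 else X (Sum.inr k))

lemma killY_skewMatrix (l i j : Fin n) :
    killY K l (skewMatrix K n i j) = skewMatrix K n i j := by
  simp only [skewMatrix, Matrix.of_apply]
  split_ifs <;> simp [killY]

lemma killY_truncG (l i : Fin n) : killY K l (truncG K l i) = truncG K l i := by
  rw [truncG, map_sum]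
  refine Finset.sum_congr rfl fun j _ => ?_
  split_ifs with h
  · have : j ≠ l := by rintro rfl; exact lt_irrefl _ h
    rw [map_mul, killY_skewMatrix]
    simp [killY, genericColumn, this]
  · exact map_zero _

lemma killY_X (l : Fin n) : killY K l (X (Sum.inr l)) = 0 := by
  simp [killY]

lemma killY_truncG_succ (l i : Fin n) :
    killY K l (truncG K ((l : ℕ) + 1) i) = truncG K l i := by
  rw [truncG_succ, map_add, map_mul, killY_X, mul_zero, add_zero, killY_truncG]

lemma sub_killY_mem (l : Fin n) (f : PolyRing K n) :
    f - killY K l f ∈ Ideal.span {(X (Sum.inr l) : PolyRing K n)} := by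
  rw [← Ideal.Quotient.mk_eq_mk_iff_sub_mem]
  have : (Ideal.Quotient.mkₐ K (Ideal.span {(X (Sum.inr l) : PolyRing K n)})) =
      (Ideal.Quotient.mkₐ K _).comp (killY K l) := by
    refine MvPolynomial.algHom_ext ?_
    rintro (p | k)
    · simp [killY]
    · by_cases h : k = l
      · subst h
        simp [killY]
      · simp [killY, h]
  exact DFunLike.congr_fun this f

lemma killY_mem_truncJ (l : Fin n) {t : ℕ} {f : PolyRing K n}
    (hf : f ∈ truncJ K n ((l : ℕ) + 1) t) : killY K l f ∈ truncJ K n l t := by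
  have : truncJ K n ((l : ℕ) + 1) t ≤ (truncJ K n l t).comap (killY K l) :=
    truncJ_le_iff.mpr fun i hi => by
      rw [Ideal.mem_comap, killY_truncG_succ]
      exact truncG_mem_truncJ hi
  exact this hf

lemma truncJ_le_succ_sup (l : Fin n) (t : ℕ) :
    truncJ K n l t ≤ truncJ K n ((l : ℕ) + 1) t ⊔ Ideal.span {X (Sum.inr l)} := by
  refine truncJ_le_iff.mpr fun i hi => ?_
  rw [eq_sub_of_add_eq (truncG_succ l i).symm]
  exact sub_mem (Ideal.mem_sup_left (truncG_mem_truncJ hi))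
    (Ideal.mem_sup_right (Ideal.mul_mem_left _ _ (Ideal.mem_span_singleton_self _)))

/-- The first `m - 1` truncated entries form a weakly regular sequence, elementwise. -/
def TruncRegular (K : Type*) [Field K] (n m : ℕ) : Prop :=
  ∀ i : Fin n, (i : ℕ) + 1 < m → ∀ f, truncG K m i * f ∈ truncJ K n m i → f ∈ truncJ K n m i

lemma mem_of_X_mul_mem (l : Fin n) (hl : TruncRegular K n l) (t : ℕ) (ht : t < l) :
    ∀ f, X (Sum.inr l) * f ∈ truncJ K n ((l : ℕ) + 1) t → f ∈ truncJ K n ((l : ℕ) + 1) t := by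
  induction t with
  | zero =>
    intro f hf
    rw [truncJ_zero, Ideal.mem_bot] at hf ⊢
    exact (mul_eq_zero.mp hf).resolve_left (X_ne_zero _)
  | succ t ih =>
    intro f hf
    obtain ⟨i, rfl⟩ : ∃ i : Fin n, (i : ℕ) = t := ⟨⟨t, by omega⟩, rfl⟩
    obtain ⟨u, hu, v, hv, huv⟩ := Submodule.mem_sup.mp (truncJ_succ_le _ i hf)
    obtain ⟨b, rfl⟩ := Ideal.mem_span_singleton'.mp hv
    have hb : killY K l b ∈ truncJ K n l i := by
      refine hl i ht _ ?_
      have h0 := congrArg (killY K l) huv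
      rw [map_add, map_mul, map_mul, killY_X, zero_mul, killY_truncG_succ] at h0
      rw [mul_comm, eq_neg_of_add_eq_zero_right h0]
      exact neg_mem (killY_mem_truncJ l hu)
    obtain ⟨w, hw, z, hz, hwz⟩ := Submodule.mem_sup.mp (truncJ_le_succ_sup l _ hb)
    obtain ⟨c, hc⟩ := Ideal.mem_span_singleton'.mp (add_mem hz (sub_killY_mem l b))
    have hbc : b = w + c * X (Sum.inr l) := by
      rw [hc, ← add_assoc, hwz]; ring
    have key : f - truncG K ((l : ℕ) + 1) i * c ∈ truncJ K n ((l : ℕ) + 1) i := by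
      refine ih (by omega) _ ?_
      have : X (Sum.inr l) * (f - truncG K ((l : ℕ) + 1) i * c) =
          u + truncG K ((l : ℕ) + 1) i * w := by
        rw [mul_sub, ← huv, hbc]; ring
      rw [this]
      exact add_mem hu (Ideal.mul_mem_left _ _ hw)
    have h1 := add_mem (truncJ_mono (Nat.le_succ (i : ℕ)) key)
      (Ideal.mul_mem_right c _ (truncG_mem_truncJ (Nat.lt_succ_self (i : ℕ))))
    rwa [sub_add_cancel] at h1

/-- The map to the fraction field that eliminates the variables `x_{il}`, for `i < t`, by means
of the equations `truncG (l + 1) i = 0`. -/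
noncomputable def elimX (K : Type*) [Field K] {n : ℕ} (l : Fin n) (t : ℕ) :
    PolyRing K n →ₐ[K] FractionRing (PolyRing K n) :=
  aeval (Sum.elim
    (fun p => if p.1.2 = l ∧ (p.1.1 : ℕ) < t then
        algebraMap (PolyRing K n) _ (X (Sum.inl p)) -
          algebraMap (PolyRing K n) _ (truncG K ((l : ℕ) + 1) p.1.1) /
            algebraMap (PolyRing K n) _ (X (Sum.inr l))
      else algebraMap (PolyRing K n) _ (X (Sum.inl p)))
    fun k => algebraMap (PolyRing K n) _ (X (Sum.inr k)))

lemma elimX_skewMatrix (l : Fin n) (t : ℕ) {i j : Fin n} (hi : i < l) (hj : j < l) :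
    elimX K l t (skewMatrix K n i j) = algebraMap (PolyRing K n) _ (skewMatrix K n i j) := by
  simp only [skewMatrix, Matrix.of_apply]
  split_ifs <;> simp [elimX, hi.ne, hj.ne]

lemma elimX_truncG_of_lt (l : Fin n) (t : ℕ) {i : Fin n} (hi : i < l) :
    elimX K l t (truncG K l i) = algebraMap (PolyRing K n) _ (truncG K l i) := by
  rw [truncG, map_sum, map_sum]
  refine Finset.sum_congr rfl fun j _ => ?_
  split_ifs with h
  · rw [map_mul, elimX_skewMatrix l t hi h, map_mul]
    simp [elimX, genericColumn]
  · rw [map_zero, map_zero]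

lemma algebraMap_X_ne_zero (l : Fin n) :
    algebraMap (PolyRing K n) (FractionRing (PolyRing K n)) (X (Sum.inr l)) ≠ 0 := by
  rw [Ne, FaithfulSMul.algebraMap_eq_zero_iff]
  exact X_ne_zero _

lemma elimX_truncG_eq_zero (l : Fin n) {t : ℕ} (ht : t ≤ l) {i : Fin n} (hi : (i : ℕ) < t) :
    elimX K l t (truncG K ((l : ℕ) + 1) i) = 0 := by
  have hil : i < l := Fin.lt_def.mpr (hi.trans_le ht)
  have hX : skewMatrix K n i l = X (Sum.inl ⟨(i, l), hil⟩) := by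
    simp [skewMatrix, hil]
  have hx : elimX K l t (X (Sum.inl ⟨(i, l), hil⟩)) =
      algebraMap (PolyRing K n) _ (X (Sum.inl ⟨(i, l), hil⟩)) -
        algebraMap (PolyRing K n) _ (truncG K ((l : ℕ) + 1) i) /
          algebraMap (PolyRing K n) _ (X (Sum.inr l)) := by
    simp [elimX, hi]
  have hy : elimX K l t (X (Sum.inr l)) = algebraMap (PolyRing K n) _ (X (Sum.inr l)) := by
    simp [elimX]
  have h0 := algebraMap_X_ne_zero (K := K) l
  rw [truncG_succ, map_add, map_mul, elimX_truncG_of_lt l t hil, hX, hx, hy, sub_mul,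
    div_mul_cancel₀ _ h0, truncG_succ, hX, map_add, map_mul]
  ring

lemma exists_elimX_eq (l : Fin n) (t : ℕ) (f : PolyRing K n) :
    ∃ (N : ℕ) (r : PolyRing K n),
      algebraMap (PolyRing K n) _ r =
        algebraMap (PolyRing K n) _ (X (Sum.inr l) ^ N) * elimX K l t f ∧
      r - X (Sum.inr l) ^ N * f ∈ truncJ K n ((l : ℕ) + 1) t := by
  induction f using MvPolynomial.induction_on with
  | C a =>
    refine ⟨0, C a, ?_, by simp⟩
    rw [pow_zero, map_one, one_mul, elimX, aeval_C, ← MvPolynomial.algebraMap_eq,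
      ← IsScalarTower.algebraMap_apply]
  | add p q hp hq =>
    obtain ⟨M, r, h1, h2⟩ := hp
    obtain ⟨N, s, h3, h4⟩ := hq
    refine ⟨M + N, X (Sum.inr l) ^ N * r + X (Sum.inr l) ^ M * s, ?_, ?_⟩
    · rw [map_add, map_mul, map_mul, h1, h3, map_add, pow_add, map_mul]; ring
    · have : X (Sum.inr l) ^ N * r + X (Sum.inr l) ^ M * s - X (Sum.inr l) ^ (M + N) * (p + q) =
          X (Sum.inr l) ^ N * (r - X (Sum.inr l) ^ M * p) +
            X (Sum.inr l) ^ M * (s - X (Sum.inr l) ^ N * q) := by ring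
      rw [this]
      exact add_mem (Ideal.mul_mem_left _ _ h2) (Ideal.mul_mem_left _ _ h4)
  | mul_X p v hp =>
    obtain ⟨M, r, h1, h2⟩ := hp
    have hv : ∃ (N : ℕ) (s : PolyRing K n),
        algebraMap (PolyRing K n) _ s =
          algebraMap (PolyRing K n) _ (X (Sum.inr l) ^ N) * elimX K l t (X v) ∧
        s - X (Sum.inr l) ^ N * X v ∈ truncJ K n ((l : ℕ) + 1) t := by
      rcases v with v | k
      · by_cases h : v.1.2 = l ∧ (v.1.1 : ℕ) < t
        · refine ⟨1, X (Sum.inr l) * X (Sum.inl v) - truncG K ((l : ℕ) + 1) v.1.1, ?_, ?_⟩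
          · have h0 := algebraMap_X_ne_zero (K := K) l
            rw [elimX, aeval_X, Sum.elim_inl, if_pos h, pow_one, mul_sub, mul_div_cancel₀ _ h0,
              map_sub, map_mul]
          · rw [pow_one, sub_sub_cancel_left]
            exact neg_mem (truncG_mem_truncJ h.2)
        · exact ⟨0, X (Sum.inl v), by simp [elimX, h], by simp⟩
      · exact ⟨0, X (Sum.inr k), by simp [elimX], by simp⟩
    obtain ⟨N, s, h3, h4⟩ := hv
    refine ⟨M + N, r * s, ?_, ?_⟩
    · rw [map_mul, h1, h3, map_mul (elimX K l t), pow_add, map_mul]; ring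
    · have : r * s - X (Sum.inr l) ^ (M + N) * (p * X v) =
          (r - X (Sum.inr l) ^ M * p) * s +
            X (Sum.inr l) ^ M * p * (s - X (Sum.inr l) ^ N * X v) := by ring
      rw [this]
      exact add_mem (Ideal.mul_mem_right _ _ h2) (Ideal.mul_mem_left _ _ h4)

lemma truncJ_eq_ker (l : Fin n) (hl : TruncRegular K n l) {t : ℕ} (ht : t < l) :
    truncJ K n ((l : ℕ) + 1) t = RingHom.ker (elimX K l t) := by
  refine le_antisymm (truncJ_le_iff.mpr fun i hi => elimX_truncG_eq_zero l ht.le hi) ?_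
  intro f hf
  obtain ⟨N, r, h1, h2⟩ := exists_elimX_eq l t f
  rw [RingHom.mem_ker] at hf
  rw [hf, mul_zero, FaithfulSMul.algebraMap_eq_zero_iff] at h1
  rw [h1, zero_sub, neg_mem_iff] at h2
  clear h1
  induction N with
  | zero => simpa using h2
  | succ N ih =>
    refine ih (mem_of_X_mul_mem l hl t ht _ ?_)
    rwa [← mul_assoc, ← pow_succ']

lemma truncJ_isPrime (l : Fin n) (hl : TruncRegular K n l) {t : ℕ} (ht : t < l) :
    (truncJ K n ((l : ℕ) + 1) t).IsPrime := by
  rw [truncJ_eq_ker l hl ht]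
  exact RingHom.ker_isPrime _

lemma truncG_notMem_truncJ (l i : Fin n) (hi : i < l) :
    truncG K ((l : ℕ) + 1) i ∉ truncJ K n ((l : ℕ) + 1) i := by
  let e : PolyRing K n →ₐ[K] K :=
    aeval (Sum.elim (fun p => if p.1 = (i, l) then 1 else 0) fun k => if k = l then 1 else 0)
  have hy (k : Fin n) : e (X (Sum.inr k)) = if k = l then 1 else 0 := by simp [e]
  have h0 (j : Fin n) : e (truncG K l j) = 0 := by
    rw [truncG, map_sum]
    refine Finset.sum_eq_zero fun k _ => ?_
    split_ifs with h
    · have : k ≠ l := by rintro rfl; exact lt_irrefl _ h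
      rw [map_mul, genericColumn, hy, if_neg this, mul_zero]
    · exact map_zero _
  have h1 (j : Fin n) (hj : j < l) :
      e (truncG K ((l : ℕ) + 1) j) = if j = i then 1 else 0 := by
    rw [truncG_succ, map_add, h0, map_mul, hy, if_pos rfl, mul_one, zero_add]
    simp [skewMatrix, hj, e]
  intro h
  have hle : truncJ K n ((l : ℕ) + 1) i ≤ RingHom.ker e :=
    truncJ_le_iff.mpr fun j hj => by
      have hji : j < i := hj
      rw [RingHom.mem_ker, h1 j (hji.trans hi), if_neg hji.ne]
  have := hle h
  rw [RingHom.mem_ker, h1 i hi, if_pos rfl] at this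
  exact one_ne_zero this

lemma truncRegular (m : ℕ) (hm : m ≤ n) : TruncRegular K n m := by
  induction m with
  | zero => exact fun i hi => absurd hi (Nat.not_lt_zero _)
  | succ m ih =>
    intro i hi f hf
    have hil : i < (⟨m, hm⟩ : Fin n) := Nat.succ_lt_succ_iff.mp hi
    exact ((truncJ_isPrime ⟨m, hm⟩ (ih (Nat.le_of_succ_le hm)) hil).mem_or_mem hf).resolve_left
      (truncG_notMem_truncJ ⟨m, hm⟩ i hil)

lemma J_isPrime {t : ℕ} (ht : t + 2 ≤ n) : (J K n t).IsPrime := by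
  obtain ⟨m, rfl⟩ : ∃ m, n = m + 1 := ⟨n - 1, by omega⟩
  rw [← truncJ_self]
  exact truncJ_isPrime (Fin.last m) (truncRegular m (Nat.le_succ m)) (t := t)
    (by rw [Fin.val_last]; omega)

lemma J_ne_top (t : ℕ) : J K n t ≠ ⊤ := by
  have h : J K n t ≤ RingHom.ker (constantCoeff (R := K)
      (σ := {p : Fin n × Fin n // p.1 < p.2} ⊕ Fin n)) := by
    rw [J, Ideal.span_le]
    rintro _ ⟨i, -, rfl⟩
    simp [g, Matrix.mulVec, dotProduct, genericColumn, RingHom.mem_ker]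
  exact fun h' => RingHom.ker_ne_top _ (top_le_iff.mp (h' ▸ h))

lemma ofList_take_ofFn_g {t : ℕ} :
    Ideal.ofList ((List.ofFn (g K n)).take t) = J K n t := by
  refine congrArg Ideal.span (Set.ext fun f => ?_)
  simp only [Set.mem_ofPred_eq, List.mem_take_iff_getElem, List.getElem_ofFn, List.length_ofFn]
  constructor
  · rintro ⟨i, hi, rfl⟩
    exact ⟨⟨i, by omega⟩, by simpa using (lt_min_iff.mp hi).1, rfl⟩
  · rintro ⟨i, hi, rfl⟩
    exact ⟨i, lt_min hi i.2, rfl⟩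

lemma g_isRegular :
    RingTheory.Sequence.IsRegular (PolyRing K n) ((List.ofFn (g K n)).take (n - 1)) := by
  refine ⟨⟨fun i hi => ?_⟩, ?_⟩
  · rw [List.length_take, List.length_ofFn] at hi
    rw [List.take_take, min_eq_left (by omega), ofList_take_ofFn_g, Ideal.smul_eq_mul,
      Ideal.mul_top, isSMulRegular_quotient_iff_mem_of_smul_mem]
    intro f hf
    rw [List.getElem_take, List.getElem_ofFn, smul_eq_mul] at hf
    rw [← truncJ_self] at hf ⊢
    rw [← truncG_self] at hf
    exact truncRegular n le_rfl ⟨i, by omega⟩ (show i + 1 < n by omega) f hf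
  · rw [ofList_take_ofFn_g, Ideal.smul_eq_mul, Ideal.mul_top]
    exact (J_ne_top _).symm

end GenericSkew

theorem theorem1p2 (K : Type*) [Field K] (n : ℕ) :
    RingTheory.Sequence.IsRegular (GenericSkew.PolyRing K n)
      ((List.ofFn (GenericSkew.g K n)).take (n - 1)) ∧
    ∀ t : ℕ, 1 ≤ t → t + 2 ≤ n → (GenericSkew.J K n t).IsPrime :=
  ⟨GenericSkew.g_isRegular, fun _ _ ht => GenericSkew.J_isPrime ht⟩
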